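/- Let $c_0<1$ and $2c_0-1<\varepsilon<c_0$. Let $f:(0,\infty)\to\mathbb C$ belong to the space ${\cal M}^{-1}_{0,(|\varepsilon|+\varepsilon)/2}(L_c)$, i.e. $$f(x)=\frac1{2\pi i}\int_{c_0-i\infty}^{c_0+i\infty} f^*(s)\,x^{-s}\,ds,\qquad x>0,$$ for some $f^*$ such that both $f^*(s)$ and $s^{(|\varepsilon|+\varepsilon)/2}f^*(s)$ are integrable on the line $c=\{{\rm Re}\,s=c_0\}$. Let $I_\nu$ and $K_\nu$ denote the modified Bessel functions and put $$(Ff)(z)=2\int_0^\infty x^{z/2}K_z(2\sqrt x)\,f(x)\,dx .$$ Let $\gamma\in(c_0-1,0)$ (in particular, any $\gamma\in(c_0-1,(\varepsilon-1)/2)$ is allowed) be such that $$\int_{|\tau|>1}|(Ff)(\gamma+i\tau)|\,|\tau|^{\gamma+1/2}e^{\pi|\tau|/2}\,d\tau<\infty .$$ Then $(Ff)(z)$ is given by an absolutely convergent integral for ${\rm Re}\,z=\gamma$, and for every $x>0$ the reciprocal inversion formula $$f(x)=\frac1{2\pi i}\,\frac{d}{dx}\int_{\gamma-i\infty}^{\gamma+i\infty}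 I_{-z}(2\sqrt x)\,x^{-z/2}\,(Ff)(z)\,dz$$ holds, its integral converges absolutely, and it can be differentiated under the integral sign: for ${\rm Re}\,z=\gamma$ $$\frac{d}{dx}\left[I_{-z}(2\sqrt x)\,x^{-z/2}\right]=I_{-(1+z)}(2\sqrt x)\,x^{-(1+z)/2},$$ and the derivative of the integral equals $\int_{\gamma-i\infty}^{\gamma+i\infty} I_{-(1+z)}(2\sqrt x)\,x^{-(1+z)/2}(Ff)(z)\,dz$. Consequently $$f(x)=\frac1{2\pi i}\int_{\gamma-i\infty}^{\gamma+i\infty} I_{-(1+z)}(2\sqrt x)\,x^{-(1+z)/2}\,(Ff)(z)\,dz,\qquad x>0,$$ where the integral converges absolutely. -/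

import Mathlib

open Complex Set MeasureTheory

noncomputable section

/-- The line integral `∫ g(z) dz` over `(γ - i∞, γ + i∞)`, with `z = γ + iτ`, `dz = i dτ`.
It has its intended meaning when `VerticalIntegrable g γ`. -/
def verticalLineIntegral (γ : ℝ) (g : ℂ → ℂ) : ℂ :=
  I * ∫ τ : ℝ, g ((γ : ℂ) + (τ : ℂ) * I)

/-- The modified Bessel function `I_ν(w)` of complex order `ν` and real argument `w > 0`,
`I_ν(w) = ∑ₙ (w/2)^(ν+2n) / (n! Γ(n+ν+1))`. Mathlib's `Gamma` is `0` at its poles, so that the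
quotient is `0` there, in agreement with the entire function `1/Γ`. -/
def besselI (ν : ℂ) (w : ℝ) : ℂ :=
  ∑' n : ℕ, ((w / 2 : ℝ) : ℂ) ^ (ν + 2 * (n : ℂ)) / ((n.factorial : ℂ) * Gamma ((n : ℂ) + ν + 1))

/-- The modified Bessel (Macdonald) function `K_ν(w)` of complex order `ν` and real argument
`w > 0`, `K_ν(w) = (1/2) (w/2)^(-ν) ∫₀^∞ exp(-t - w²/(4t)) t^(ν-1) dt`. -/
def besselK (ν : ℂ) (w : ℝ) : ℂ :=
  ((w / 2 : ℝ) : ℂ) ^ (-ν) / 2 *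
    ∫ t in Ioi (0 : ℝ), ((Real.exp (-t - w ^ 2 / (4 * t)) : ℝ) : ℂ) * (t : ℂ) ^ (ν - 1)

/-- The space `M⁻¹_{c₁,c₂}(L_c)`, `c = {Re s = c₀}`: the functions on `(0, ∞)` of the form
`f(x) = (1/(2πi)) ∫_c f*(s) x^(-s) ds` with `f*` integrable on `c` and
`s^{c₂} e^{π c₁ |s|} f*(s)` integrable on `c`. Only the values of `f` on `(0, ∞)` matter. -/
def inverseMellinSpace (c₀ c₁ c₂ : ℝ) : Set (ℝ → ℂ) :=
  {f | ∃ fstar : ℂ → ℂ,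
    VerticalIntegrable fstar c₀ ∧
    VerticalIntegrable
      (fun s : ℂ => s ^ (c₂ : ℂ) * ((Real.exp (Real.pi * c₁ * ‖s‖) : ℝ) : ℂ) * fstar s) c₀ ∧
    ∀ x : ℝ, 0 < x → f x = mellinInv c₀ fstar x}

/-- The integrand `x^{z/2} K_z(2√x) f(x)` of the index transform. -/
def indexIntegrand (f : ℝ → ℂ) (z : ℂ) (x : ℝ) : ℂ :=
  (x : ℂ) ^ (z / 2) * besselK z (2 * √x) * f x

/-- The index transform `(Ff)(z) = 2 ∫₀^∞ x^{z/2} K_z(2√x) f(x) dx`. -/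
def indexTransform (f : ℝ → ℂ) (z : ℂ) : ℂ :=
  2 * ∫ x in Ioi (0 : ℝ), indexIntegrand f z x

/-- The integrability condition
`(Ff)(γ + iτ) ∈ L₁(|τ| > 1; |τ|^{γ+1/2} e^{π|τ|/2} dτ)`. -/
def ExpIntegrableTransform (f : ℝ → ℂ) (γ : ℝ) : Prop :=
  IntegrableOn
    (fun τ : ℝ => ((|τ| ^ (γ + 1 / 2) * Real.exp (Real.pi * |τ| / 2) : ℝ) : ℂ) *
      indexTransform f ((γ : ℂ) + (τ : ℂ) * I))
    {τ : ℝ | 1 < |τ|}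

/-- The kernel `I_{-z}(2√x) x^{-z/2}`. -/
def inversionKernel (z : ℂ) (x : ℝ) : ℂ :=
  besselI (-z) (2 * √x) * (x : ℂ) ^ (-z / 2)

/-- The kernel `I_{-(1+z)}(2√x) x^{-(1+z)/2}`. -/
def inversionKernelDeriv (z : ℂ) (x : ℝ) : ℂ :=
  besselI (-(1 + z)) (2 * √x) * (x : ℂ) ^ (-(1 + z) / 2)

end

/-! The Laplace transform turns the index transform into a Mellin transform. Membership in the space
enters through two facts: `f` is continuous on `(0, ∞)` and `|f(x)| ≤ C x^(-c₀)`. Inserting the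
integral for `K_z` and applying Fubini shows that `Ff` is the Mellin transform of `g(t) = e^(-t)
(Lf)(1/t)`, with `L` the Laplace transform (`indexTransform_eq_mellin`). The inversion kernel is a
power series `∑ x^(n+s-1) / (n! Γ(n+s))` with `s = -z`, whose Laplace transform is `p^(-s) e^(1/p)`
(`laplace_powerKernel`).

Let `G` be the right-hand side of the inversion formula. For `p > 1`, `(LG)(p)` is `e^(1/p)` times
the inverse Mellin integral of `Ff` at `t = 1/p`. By Mellin inversion this equals `e^(1/p) g(1/p) =
(Lf)(p)`, and uniqueness of Laplace transforms of continuous functions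
(`eq_zero_of_laplace_eq_zero`) gives `f = G`.

All interchanges rest on one majorant: on `Re z = γ` the kernel is at most a function of `x` times
`1/|Γ(-z)|`. A Stirling-type bound (`inv_norm_Gamma_le`) gives `1/|Γ(-z)| = O(|τ|^(γ+1/2)
e^(π|τ|/2))`, which is exactly the weight in the integrability assumption
(`integrable_transformWeight`). -/

/-! ### Stirling-type bounds for the Gamma function on vertical lines. -/

theorem norm_Gamma_le_Gamma_re {s : ℂ} (hs : 0 < s.re) : ‖Gamma s‖ ≤ Real.Gamma s.re := by
  rw [Gamma_eq_integral hs, Real.Gamma_eq_integral hs, Complex.GammaIntegral]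
  refine (norm_integral_le_integral_norm _).trans_eq ?_
  refine setIntegral_congr_fun measurableSet_Ioi fun x hx => ?_
  have hx' : (0 : ℝ) < x := hx
  simp only [norm_mul, norm_cpow_eq_rpow_re_of_pos hx', sub_re, one_re, norm_real]
  rw [Real.norm_of_nonneg (Real.exp_pos _).le]

/-- Reflection formula on the critical line, where `1 - s` is the conjugate of `s`. -/
theorem norm_Gamma_half_sq (τ : ℝ) :
    ‖Gamma (1 / 2 + τ * I)‖ ^ 2 = Real.pi / Real.cosh (Real.pi * τ) := by
  have h := Gamma_mul_Gamma_one_sub (1 / 2 + τ * I)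
  have h1 : (1 : ℂ) - (1 / 2 + τ * I) = (starRingEnd ℂ) (1 / 2 + τ * I) := by
    simp only [map_add, map_mul, conj_ofReal, conj_I, map_div₀, map_one, map_ofNat]
    ring
  have h2 : sin (Real.pi * (1 / 2 + τ * I)) = (Real.cosh (Real.pi * τ) : ℂ) := by
    rw [mul_add, mul_one_div, add_comm, sin_add_pi_div_two, ← mul_assoc, cos_mul_I]
    push_cast; rfl
  rw [h1, Gamma_conj, mul_conj, h2, normSq_eq_norm_sq] at h
  exact_mod_cast h

theorem norm_Gamma_half_mul_exp_le (τ : ℝ) :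
    ‖Gamma (1 / 2 + τ * I)‖ * Real.exp (Real.pi * τ / 2) ≤ √(2 * Real.pi) := by
  apply Real.le_sqrt_of_sq_le
  rw [mul_pow, norm_Gamma_half_sq, ← Real.exp_nat_mul, Real.cosh_eq]
  have h1 := Real.exp_pos (Real.pi * τ)
  have h2 := Real.exp_pos (-(Real.pi * τ))
  have h3 : ((2 : ℕ) : ℝ) * (Real.pi * τ / 2) = Real.pi * τ := by push_cast; ring
  rw [h3, div_mul_eq_mul_div, div_le_iff₀ (by positivity)]
  nlinarith [mul_pos Real.pi_pos h2]

/-- `Γ(s)` normalized by its size at height `T`, for the Phragmén–Lindelöf principle. -/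
noncomputable def gammaNormalized (T : ℝ) (s : ℂ) : ℂ :=
  Gamma s * exp (-(I * Real.pi * s / 2) - (s - 1 / 2) * Real.log T) * (T / (s + T))

theorem norm_gammaNormalized {T : ℝ} (hT : 0 < T) (s : ℂ) :
    ‖gammaNormalized T s‖ = ‖Gamma s‖ * Real.exp (Real.pi * s.im / 2) *
      Real.exp (-((s.re - 1 / 2) * Real.log T)) * (T / ‖s + T‖) := by
  rw [gammaNormalized, norm_mul, norm_mul, norm_div, norm_exp, norm_real,
    Real.norm_of_nonneg hT.le, mul_assoc ‖Gamma s‖ (Real.exp (Real.pi * s.im / 2)),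
    ← Real.exp_add]
  congr 3
  simp [sub_re, neg_re, mul_re, mul_im, normSq]
  ring

theorem div_norm_add_le_one {T : ℝ} {s : ℂ} (hs : 0 ≤ s.re) : T / ‖s + T‖ ≤ 1 := by
  have h := (abs_re_le_norm (s + T)).trans' (le_abs_self _)
  simp only [add_re, ofReal_re] at h
  exact div_le_one_of_le₀ (by linarith) (norm_nonneg _)

/-- Phragmén–Lindelöf reduces the bound to the two edges. On `Re s = 1/2` the exponential factor
cancels the decay of `Γ`, which is known exactly there. On `Re s = 3/2`, `Γ(s) = (s-1) Γ(s-1)`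
brings an extra `|s-1|`; it is absorbed by `T^(-1)` from the power of `T` together with `T/|s+T|`,
because `|s-1| ≤ |s+T|`. -/
theorem norm_gammaNormalized_le {T : ℝ} (hT : 1 ≤ T) {s : ℂ} (h1 : 1 / 2 ≤ s.re)
    (h2 : s.re ≤ 3 / 2) : ‖gammaNormalized T s‖ ≤ √(2 * Real.pi) := by
  have hT0 : 0 < T := by linarith
  refine PhragmenLindelof.vertical_strip (a := 1 / 2) (b := 3 / 2) ?_ ?_ ?_ ?_ h1 h2
  · refine DifferentiableOn.diffContOnCl fun z hz => ?_
    have hz' : z ∈ re ⁻¹' Icc (1 / 2 : ℝ) (3 / 2) :=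
      closure_minimal (preimage_mono Ioo_subset_Icc_self) (isClosed_Icc.preimage continuous_re) hz
    have hz1 : (1 / 2 : ℝ) ≤ z.re := hz'.1
    have hG : DifferentiableAt ℂ Gamma z := by
      refine differentiableAt_Gamma z fun m h => ?_
      have := congrArg re h
      simp only [neg_re, natCast_re] at this
      have hm : (0 : ℝ) ≤ m := m.cast_nonneg
      linarith
    have hne : z + T ≠ 0 := by
      intro h
      have := congrArg re h
      simp only [add_re, ofReal_re, zero_re] at this
      linarith
    apply DifferentiableAt.differentiableWithinAt
    unfold gammaNormalized
    exact (hG.mul (by fun_prop)).mul (DifferentiableAt.div (by fun_prop) (by fun_prop) hne)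
  · obtain ⟨M, hM⟩ := (isCompact_Icc (a := (1 / 2 : ℝ)) (b := 3 / 2)).exists_bound_of_continuousOn
      (f := Real.Gamma) fun x hx => (Real.differentiableAt_Gamma fun m h => by
        have hm : (0 : ℝ) ≤ m := m.cast_nonneg
        have := hx.1
        linarith).continuousAt.continuousWithinAt
    -- The strip has width 1, so growth `exp(B e^(c|Im s|))` is admissible for any `c < π`; here `c
    -- = 1`, `B = 2`.
    refine ⟨1, ?_, 2, Asymptotics.IsBigO.of_bound M ?_⟩
    · rw [lt_div_iff₀ (by norm_num)]
      linarith [Real.pi_gt_three]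
    refine Filter.eventually_inf_principal.mpr (.of_forall fun z hz => ?_)
    obtain ⟨hz1, hz2⟩ : 1 / 2 < z.re ∧ z.re < 3 / 2 := hz
    have hMz := (hM z.re ⟨hz1.le, hz2.le⟩)
    have hΓ := (norm_Gamma_le_Gamma_re (s := z) (by linarith)).trans ((le_abs_self _).trans hMz)
    have hM0 : 0 ≤ M := (norm_nonneg _).trans hΓ
    rw [norm_gammaNormalized hT0, Real.norm_of_nonneg (Real.exp_pos _).le]
    have e1 : Real.exp (-((z.re - 1 / 2) * Real.log T)) ≤ 1 := by
      rw [Real.exp_le_one_iff, neg_nonpos]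
      exact mul_nonneg (by linarith) (Real.log_nonneg hT)
    have e2 : Real.exp (Real.pi * z.im / 2) ≤ Real.exp (2 * Real.exp (1 * |z.im|)) := by
      apply Real.exp_le_exp.mpr
      have a1 := Real.add_one_le_exp |z.im|
      have a2 : Real.pi * z.im ≤ 4 * |z.im| :=
        (mul_le_mul_of_nonneg_left (le_abs_self _) Real.pi_pos.le).trans
          (mul_le_mul_of_nonneg_right Real.pi_le_four (abs_nonneg _))
      rw [one_mul]
      linarith
    have e3 := div_norm_add_le_one (T := T) (s := z) (by linarith)
    calc _ ≤ M * Real.exp (2 * Real.exp (1 * |z.im|)) * 1 * 1 := by gcongr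
      _ = _ := by ring
  · intro z hz
    have e3 := div_norm_add_le_one (T := T) (s := z) (by linarith)
    have hz' : z = 1 / 2 + z.im * I := by
      apply Complex.ext <;> simp [hz]
    have h := norm_Gamma_half_mul_exp_le z.im
    rw [← hz'] at h
    rw [norm_gammaNormalized hT0, hz]
    simp only [sub_self, zero_mul, neg_zero, Real.exp_zero, mul_one]
    exact (mul_le_of_le_one_right (by positivity) e3).trans h
  · intro z hz
    have hz' : z = (1 / 2 + z.im * I) + 1 := by
      apply Complex.ext <;> norm_num [hz]
    have hne : (1 / 2 + z.im * I : ℂ) ≠ 0 := fun h => by simpa using congrArg re h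
    have h := norm_Gamma_half_mul_exp_le z.im
    have hΓ : ‖Gamma z‖ = ‖(1 / 2 + z.im * I : ℂ)‖ * ‖Gamma (1 / 2 + z.im * I)‖ := by
      conv_lhs => rw [hz', Gamma_add_one _ hne, norm_mul]
    have hle : ‖(1 / 2 + z.im * I : ℂ)‖ ≤ ‖z + T‖ := by
      rw [Complex.norm_def, Complex.norm_def]
      apply Real.sqrt_le_sqrt
      simp [normSq_apply, hz]
      nlinarith
    have hpos : 0 < ‖z + T‖ := (norm_pos_iff.mpr hne).trans_le hle
    rw [norm_gammaNormalized hT0, hz, hΓ]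
    have eT : Real.exp (-((3 / 2 - 1 / 2) * Real.log T)) = T⁻¹ := by
      norm_num [Real.exp_neg, Real.exp_log hT0]
    rw [eT]
    calc _ = (‖Gamma (1 / 2 + z.im * I)‖ * Real.exp (Real.pi * z.im / 2)) *
          (‖(1 / 2 + z.im * I : ℂ)‖ / ‖z + T‖) := by field_simp
      _ ≤ _ := (mul_le_of_le_one_right (by positivity) (div_le_one_of_le₀ hle hpos.le)).trans h

/-- An upper bound for `Γ` in the strip `1/2 ≤ Re s ≤ 3/2`, of the order given by Stirling. -/
theorem norm_Gamma_le_of_mem_strip {σ T : ℝ} (h1 : 1 / 2 ≤ σ) (h2 : σ ≤ 3 / 2) (hT : 1 ≤ T) :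
    ‖Gamma (σ + T * I)‖ ≤
      4 * √(2 * Real.pi) * (T ^ (σ - 1 / 2) * Real.exp (-(Real.pi * T / 2))) := by
  have hT0 : 0 < T := by linarith
  have h := norm_gammaNormalized_le hT (s := σ + T * I) (by simpa using h1) (by simpa using h2)
  rw [norm_gammaNormalized hT0] at h
  simp only [add_re, ofReal_re, mul_re, I_re, mul_zero, ofReal_im, I_im, mul_one, sub_self,
    add_zero, add_im, mul_im, zero_add] at h
  -- The normalization is used at height `Im s = T`, where the correcting factor `T/|s+T|` is at
  -- least `1/4`; this produces the constant 4.
  have hn : ‖(σ + T * I + T : ℂ)‖ ≤ 4 * T := by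
    refine (norm_add_le _ _).trans ((add_le_add_left (norm_add_le _ _) _).trans ?_)
    simp only [norm_mul, norm_real, norm_I, mul_one, Real.norm_eq_abs, abs_of_pos hT0,
      abs_of_pos (by linarith : 0 < σ)]
    linarith
  have hpos : 0 < ‖(σ + T * I + T : ℂ)‖ := by
    rw [norm_pos_iff]
    intro h0
    have := congrArg im h0
    simp at this
    linarith
  have hq : 1 / 4 ≤ T / ‖(σ + T * I + T : ℂ)‖ := by
    rw [div_le_div_iff₀ (by norm_num) hpos]; linarith
  have hTe : T ^ (σ - 1 / 2) * Real.exp (-((σ - 1 / 2) * Real.log T)) = 1 := by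
    rw [Real.rpow_def_of_pos hT0, ← Real.exp_add]; ring_nf; simp
  have hE : Real.exp (Real.pi * T / 2) * Real.exp (-(Real.pi * T / 2)) = 1 := by
    rw [← Real.exp_add]; simp
  set G := ‖Gamma (σ + T * I)‖
  set q := T / ‖(σ + T * I + T : ℂ)‖
  set E := Real.exp (Real.pi * T / 2)
  set E' := Real.exp (-(Real.pi * T / 2))
  set P := T ^ (σ - 1 / 2)
  set P' := Real.exp (-((σ - 1 / 2) * Real.log T))
  have hP : 0 < P := Real.rpow_pos_of_pos hT0 _
  have hE' : 0 < E' := Real.exp_pos _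
  have hEp : 0 < E := Real.exp_pos _
  have hPp : 0 < P' := Real.exp_pos _
  have hG : 0 ≤ G := norm_nonneg _
  calc G = (G * E * P' * (1 / 4)) * (4 * (P * E')) := by
        linear_combination (-G) * (P * P') * hE - G * hTe
    _ ≤ √(2 * Real.pi) * (4 * (P * E')) := by
        gcongr
        refine le_trans ?_ h
        gcongr
    _ = _ := by ring

/-- Descent from the strip by `Γ(s+1) = sΓ(s)`: since `|s| ≥ T`, each unit step to the left gains a
full factor `T`, so the constant does not deteriorate. -/
theorem norm_Gamma_le_of_re_le {σ T : ℝ} (hσ : σ ≤ 3 / 2) (hT : 1 ≤ T) :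
    ‖Gamma (σ + T * I)‖ ≤
      4 * √(2 * Real.pi) * (T ^ (σ - 1 / 2) * Real.exp (-(Real.pi * T / 2))) := by
  have hT0 : 0 < T := by linarith
  have key : ∀ (n : ℕ) (σ : ℝ), σ ≤ 3 / 2 → 1 / 2 ≤ σ + n → ‖Gamma (σ + T * I)‖ ≤
      4 * √(2 * Real.pi) * (T ^ (σ - 1 / 2) * Real.exp (-(Real.pi * T / 2))) := by
    intro n
    induction n with
    | zero => intro σ h1 h2; exact norm_Gamma_le_of_mem_strip (by simpa using h2) h1 hT
    | succ n ih =>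
      intro σ h1 h2
      by_cases h3 : 1 / 2 ≤ σ
      · exact norm_Gamma_le_of_mem_strip h3 h1 hT
      have h4 := ih (σ + 1) (by linarith) (by push_cast at h2; linarith)
      have hne : (σ + T * I : ℂ) ≠ 0 := fun h => by
        have := congrArg im h
        simp at this
        linarith
      have hTn : T ≤ ‖(σ + T * I : ℂ)‖ := by
        simpa using (abs_im_le_norm (σ + T * I : ℂ)).trans' (le_abs_self _)
      have e : ((σ + 1 : ℝ) + T * I : ℂ) = (σ + T * I) + 1 := by push_cast; ring
      rw [e, Gamma_add_one _ hne, norm_mul, show σ + 1 - 1 / 2 = (σ - 1 / 2) + 1 by ring,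
        Real.rpow_add_one hT0.ne'] at h4
      have h5 : T * ‖Gamma (σ + T * I)‖ ≤ T *
          (4 * √(2 * Real.pi) * (T ^ (σ - 1 / 2) * Real.exp (-(Real.pi * T / 2)))) :=
        (mul_le_mul_of_nonneg_right hTn (norm_nonneg _)).trans (h4.trans_eq (by ring))
      exact le_of_mul_le_mul_left h5 hT0
  obtain ⟨n, hn⟩ := exists_nat_ge (1 / 2 - σ)
  exact key n σ hσ (by linarith)

/-- A lower bound for `Γ` on vertical lines, of the order given by Stirling. -/
theorem inv_norm_Gamma_le {a τ : ℝ} (ha : 0 < a) (hτ : 1 ≤ |τ|) :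
    ‖Gamma (a + τ * I)‖⁻¹ ≤
      4 * √(2 * Real.pi) / Real.pi * (|τ| ^ (1 / 2 - a) * Real.exp (Real.pi * |τ| / 2)) := by
  wlog hp : 0 ≤ τ generalizing τ
  · have h := this (τ := -τ) (by simpa using hτ) (by linarith)
    rw [abs_neg] at h
    have e : (a + (-τ : ℝ) * I : ℂ) = (starRingEnd ℂ) (a + τ * I) := by simp
    rwa [e, Gamma_conj, norm_conj] at h
  rw [abs_of_nonneg hp] at hτ ⊢
  -- By reflection `1/|Γ(s)| = |Γ(1-s)| |sin πs| / π`; an upper bound for `Γ` at real part `1 - a`,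
  -- possibly far to the left, then becomes a lower bound at real part `a`.
  have h := congrArg norm (Gamma_mul_Gamma_one_sub (a + τ * I))
  have e : (1 - (a + τ * I) : ℂ) = (starRingEnd ℂ) ((1 - a : ℝ) + τ * I) := by
    simp; ring
  rw [e, Gamma_conj, norm_mul, norm_conj, norm_div, norm_real, Real.norm_of_nonneg Real.pi_pos.le]
    at h
  have hu := norm_Gamma_le_of_re_le (σ := 1 - a) (by linarith) hτ
  have hs : ‖sin (Real.pi * (a + τ * I))‖ ≤ Real.exp (Real.pi * τ) := by
    rw [sin, norm_div, norm_mul, norm_I, mul_one]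
    have e1 : ‖exp (-(Real.pi * (a + τ * I)) * I)‖ = Real.exp (Real.pi * τ) := by
      rw [norm_exp]; simp
    have e2 : ‖exp (Real.pi * (a + τ * I) * I)‖ = Real.exp (-(Real.pi * τ)) := by
      rw [norm_exp]; simp
    have e3 : Real.exp (-(Real.pi * τ)) ≤ Real.exp (Real.pi * τ) :=
      Real.exp_le_exp.mpr (by nlinarith [Real.pi_pos])
    have := norm_sub_le (exp (-(Real.pi * (a + τ * I)) * I)) (exp (Real.pi * (a + τ * I) * I))
    rw [e1, e2] at this
    norm_num
    norm_num at this
    linarith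
  have hG : 0 < ‖Gamma (a + τ * I)‖ := by
    rw [norm_pos_iff]
    exact Gamma_ne_zero_of_re_pos (by simpa using ha)
  have hS : 0 < ‖sin (Real.pi * (a + τ * I))‖ := by
    rw [norm_pos_iff]
    intro h0
    rw [Complex.sin_eq_zero_iff] at h0
    obtain ⟨k, hk⟩ := h0
    have := congrArg im hk
    simp at this
    linarith
  rw [eq_div_iff hS.ne'] at h
  rw [show (1 - a - 1 / 2) = 1 / 2 - a by ring] at hu
  have hE : Real.exp (Real.pi * τ / 2) = Real.exp (-(Real.pi * τ / 2)) * Real.exp (Real.pi * τ) := by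
    rw [← Real.exp_add]; ring_nf
  rw [hE, inv_le_iff_one_le_mul₀' hG]
  have hpi := Real.pi_pos
  rw [← mul_le_mul_iff_of_pos_left hpi]
  calc Real.pi * 1 = ‖Gamma (a + τ * I)‖ * ‖Gamma ((1 - a : ℝ) + τ * I)‖ *
        ‖sin (Real.pi * (a + τ * I))‖ := by rw [h, mul_one]
    _ ≤ ‖Gamma (a + τ * I)‖ * (4 * √(2 * Real.pi) * (τ ^ (1 / 2 - a) *
        Real.exp (-(Real.pi * τ / 2)))) * Real.exp (Real.pi * τ) := by gcongr
    _ = _ := by field_simp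

/-- `Γ(n + s)` is no smaller than `Γ(s)`, up to a constant that depends on `Re s` only. -/
theorem le_norm_Gamma_natCast_add {s : ℂ} (hs : 0 < s.re) (n : ℕ) :
    min 1 s.re * ‖Gamma s‖ ≤ ‖Gamma (n + s)‖ := by
  have hstep : ∀ n : ℕ, ‖Gamma ((n + 1 : ℕ) + s)‖ = ‖(n + s : ℂ)‖ * ‖Gamma (n + s)‖ := fun n => by
    have hne : (n + s : ℂ) ≠ 0 := fun h => by
      have := congrArg re h
      simp at this
      have hm : (0 : ℝ) ≤ n := n.cast_nonneg
      linarith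
    rw [← norm_mul, ← Gamma_add_one _ hne]
    push_cast
    congr 2
    ring
  have hre : ∀ n : ℕ, n + s.re ≤ ‖(n + s : ℂ)‖ := fun n => by
    simpa using (abs_re_le_norm (n + s : ℂ)).trans' (le_abs_self _)
  -- `|Γ(n+s)|` is `|Γ(s)|` times the product of `|k+s|` over `k < n`. Only the factor `k = 0` can
  -- be below 1, and it is at least `Re s`.
  rcases n with _ | n
  · simpa using mul_le_of_le_one_left (norm_nonneg _) (min_le_left _ _)
  induction n with
  | zero =>
    rw [hstep]
    have := hre 0
    simp only [Nat.cast_zero, zero_add] at this ⊢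
    exact mul_le_mul_of_nonneg_right ((min_le_right _ _).trans this) (norm_nonneg _)
  | succ n ih =>
    rw [hstep]
    have := hre (n + 1)
    push_cast at this ih ⊢
    have hm : (0 : ℝ) ≤ n := n.cast_nonneg
    exact ih.trans (le_mul_of_one_le_left (norm_nonneg _) (by linarith))

/-! ### The inversion kernel as a power series: bounds, derivative, Laplace transform. -/

theorem integrableOn_rpow_mul_exp_neg_mul {a r : ℝ} (ha : 0 < a) (hr : 0 < r) :
    IntegrableOn (fun x : ℝ => x ^ (a - 1) * Real.exp (-(r * x))) (Ioi 0) := by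
  simpa using integrableOn_rpow_mul_exp_neg_mul_rpow (p := 1) (s := a - 1) (by linarith)
    one_pos hr

/-- The `n`-th term of `∑ₙ x^(n+s-1) / (n! Γ(n+s))`. -/
noncomputable def powerKernelTerm (s : ℂ) (n : ℕ) (x : ℝ) : ℂ :=
  (x : ℂ) ^ (n + s - 1) * (Gamma (n + s))⁻¹ / n.factorial

/-- The function `∑ₙ x^(n+s-1) / (n! Γ(n+s))`, that is `x^((s-1)/2) I_{s-1}(2√x)`. -/
noncomputable def powerKernel (s : ℂ) (x : ℝ) : ℂ := ∑' n : ℕ, powerKernelTerm s n x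

/-- Since `2√x/2 = √x`, the `n`-th Bessel term carries `x^(n-z/2)`, and the factor `x^(-z/2)`
completes it to `x^(n-z)`. -/
theorem inversionKernel_eq_powerKernel {x : ℝ} (hx : 0 < x) (z : ℂ) :
    inversionKernel z x = powerKernel (1 - z) x := by
  rw [inversionKernel, besselI, powerKernel, ← tsum_mul_right]
  refine tsum_congr fun n => ?_
  have h1 : ((2 * √x / 2 : ℝ) : ℂ) ≠ 0 := by
    rw [ofReal_ne_zero]
    have := Real.sqrt_pos.mpr hx
    positivity
  have h2 : (x : ℂ) ≠ 0 := ofReal_ne_zero.mpr hx.ne'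
  have h3 : (n + (1 - z) - 1 : ℂ) = n - z := by ring
  have h4 : (n + (1 - z) : ℂ) = n + -z + 1 := by ring
  have h5 : ((2 * √x / 2 : ℝ) : ℂ) ^ (-z + 2 * (n : ℂ)) * (x : ℂ) ^ (-z / 2) =
      (x : ℂ) ^ (n - z : ℂ) := by
    rw [cpow_def_of_ne_zero h1, cpow_def_of_ne_zero h2, cpow_def_of_ne_zero h2, ← exp_add,
      ← ofReal_log (by positivity), ← ofReal_log hx.le, mul_div_cancel_left₀ _ two_ne_zero,
      Real.log_sqrt hx.le]
    congr 1
    push_cast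
    ring
  rw [powerKernelTerm, h3, h4, ← h5]
  field_simp

theorem inversionKernelDeriv_eq_powerKernel {x : ℝ} (hx : 0 < x) (z : ℂ) :
    inversionKernelDeriv z x = powerKernel (-z) x := by
  rw [show inversionKernelDeriv z x = inversionKernel (1 + z) x from rfl,
    inversionKernel_eq_powerKernel hx]
  congr 1
  ring

/-- The constant in the bound of `powerKernel`. -/
noncomputable def powerKernelConst (s : ℂ) : ℝ := (min 1 s.re * ‖Gamma s‖)⁻¹

theorem norm_powerKernelTerm_le {s : ℂ} (hs : 0 < s.re) (n : ℕ) {x : ℝ} (hx : 0 < x) :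
    ‖powerKernelTerm s n x‖ ≤ x ^ (s.re - 1) * powerKernelConst s * (x ^ n / n.factorial) := by
  have hΓ : 0 < ‖Gamma s‖ := norm_pos_iff.mpr (Gamma_ne_zero_of_re_pos hs)
  have hm : 0 < min 1 s.re := lt_min one_pos hs
  rw [powerKernelTerm, norm_div, norm_mul, norm_inv, norm_cpow_eq_rpow_re_of_pos hx, norm_natCast]
  have e : (n + s - 1 : ℂ).re = (s.re - 1) + n := by simp; ring
  rw [e, Real.rpow_add hx, Real.rpow_natCast, powerKernelConst]
  have h := inv_anti₀ (mul_pos hm hΓ) (le_norm_Gamma_natCast_add hs n)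
  calc _ ≤ x ^ (s.re - 1) * x ^ n * (min 1 s.re * ‖Gamma s‖)⁻¹ / n.factorial := by gcongr
    _ = _ := by ring

theorem powerKernelConst_nonneg {s : ℂ} (hs : 0 < s.re) : 0 ≤ powerKernelConst s := by
  have hm : 0 < min 1 s.re := lt_min one_pos hs
  unfold powerKernelConst
  positivity

theorem hasSum_powerKernel_bound (c x : ℝ) :
    HasSum (fun n : ℕ => c * (x ^ n / n.factorial)) (c * Real.exp x) := by
  rw [Real.exp_eq_exp_ℝ]
  exact (NormedSpace.expSeries_div_hasSum_exp x).mul_left c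

theorem summable_powerKernelTerm {s : ℂ} (hs : 0 < s.re) {x : ℝ} (hx : 0 < x) :
    Summable fun n => powerKernelTerm s n x :=
  .of_norm_bounded (hasSum_powerKernel_bound _ x).summable
    fun n => norm_powerKernelTerm_le hs n hx

theorem norm_powerKernel_le {s : ℂ} (hs : 0 < s.re) {x : ℝ} (hx : 0 < x) :
    ‖powerKernel s x‖ ≤ x ^ (s.re - 1) * powerKernelConst s * Real.exp x :=
  tsum_of_norm_bounded (hasSum_powerKernel_bound _ x) fun n => norm_powerKernelTerm_le hs n hx

theorem rpow_le_add_of_mem_Ioo {a b y r : ℝ} (ha : 0 < a) (hy : y ∈ Ioo a b) :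
    y ^ r ≤ a ^ r + b ^ r := by
  have hy0 := ha.trans hy.1
  rcases le_total 0 r with hr | hr
  · have h1 := Real.rpow_le_rpow hy0.le hy.2.le hr
    linarith [Real.rpow_nonneg ha.le r]
  · have h1 := Real.rpow_le_rpow_of_nonpos ha hy.1.le hr
    linarith [Real.rpow_nonneg (hy0.trans hy.2).le r]

theorem norm_powerKernelTerm_le_of_mem_Ioo {s : ℂ} (hs : 0 < s.re) (n : ℕ) {a b y : ℝ}
    (ha : 0 < a) (hy : y ∈ Ioo a b) :
    ‖powerKernelTerm s n y‖ ≤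
      (a ^ (s.re - 1) + b ^ (s.re - 1)) * powerKernelConst s * (b ^ n / n.factorial) := by
  have hy0 := ha.trans hy.1
  have hC := powerKernelConst_nonneg hs
  refine (norm_powerKernelTerm_le hs n hy0).trans ?_
  have := rpow_le_add_of_mem_Ioo (r := s.re - 1) ha hy
  have := pow_le_pow_left₀ hy0.le hy.2.le n
  have := Real.rpow_nonneg ha.le (s.re - 1)
  have := Real.rpow_nonneg (hy0.trans hy.2).le (s.re - 1)
  gcongr

theorem hasDerivAt_powerKernelTerm {s : ℂ} (hs : 0 < s.re) (n : ℕ) {x : ℝ} (hx : 0 < x) :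
    HasDerivAt (powerKernelTerm (s + 1) n) (powerKernelTerm s n x) x := by
  have hne : (n + s : ℂ) ≠ 0 := fun h => by
    have := congrArg re h
    simp at this
    have hm : (0 : ℝ) ≤ n := n.cast_nonneg
    linarith
  have h1 : HasDerivAt (fun y : ℝ => (y : ℂ) ^ (n + s)) ((n + s) * (x : ℂ) ^ (n + s - 1)) x := by
    simpa using ((hasDerivAt_id (x : ℂ)).cpow_const (c := n + s)
      (Or.inl (by simpa using hx))).comp_ofReal
  have h2 := (h1.mul_const (Gamma (n + (s + 1)))⁻¹).div_const (n.factorial : ℂ)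
  have e1 : (n + (s + 1) - 1 : ℂ) = n + s := by ring
  have e2 : powerKernelTerm (s + 1) n =
      fun y : ℝ => (y : ℂ) ^ (n + s) * (Gamma (n + (s + 1)))⁻¹ / n.factorial := by
    funext y
    rw [powerKernelTerm, e1]
  have e3 : powerKernelTerm s n x =
      (n + s) * (x : ℂ) ^ (n + s - 1) * (Gamma (n + (s + 1)))⁻¹ / n.factorial := by
    rw [powerKernelTerm, ← add_assoc, Gamma_add_one _ hne]
    field_simp
  rw [e2, e3]
  exact h2

/-- Termwise differentiation lowers `s` by one, as `Γ(n+s+1) = (n+s)Γ(n+s)`; with `s = -z` this is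
the derivative relation between the two inversion kernels. -/
theorem hasDerivAt_powerKernel {s : ℂ} (hs : 0 < s.re) {x : ℝ} (hx : 0 < x) :
    HasDerivAt (powerKernel (s + 1)) (powerKernel s x) x := by
  have hmem : x ∈ Ioo (x / 2) (2 * x) := ⟨by linarith, by linarith⟩
  exact hasDerivAt_tsum_of_isPreconnected
    (hasSum_powerKernel_bound ((( x / 2) ^ (s.re - 1) + (2 * x) ^ (s.re - 1)) *
      powerKernelConst s) (2 * x)).summable isOpen_Ioo isPreconnected_Ioo
    (fun n y hy => hasDerivAt_powerKernelTerm hs n ((half_pos hx).trans hy.1))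
    (fun n y hy => norm_powerKernelTerm_le_of_mem_Ioo hs n (half_pos hx) hy) hmem
    (summable_powerKernelTerm (by simp; linarith) hx) hmem

theorem continuousOn_powerKernelTerm (s : ℂ) (n : ℕ) : ContinuousOn (powerKernelTerm s n) (Ioi 0) := by
  unfold powerKernelTerm
  refine ContinuousOn.div_const (ContinuousOn.mul (ContinuousOn.cpow_const (by fun_prop) ?_)
    continuousOn_const) _
  exact fun x hx => Or.inl (by simpa using hx)

theorem continuousAt_powerKernel {s : ℂ} (hs : 0 < s.re) {x : ℝ} (hx : 0 < x) :
    ContinuousAt (powerKernel s) x := by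
  have hmem : Ioo (x / 2) (2 * x) ∈ nhds x := Ioo_mem_nhds (by linarith) (by linarith)
  refine ContinuousOn.continuousAt (s := Ioo (x / 2) (2 * x)) ?_ hmem
  exact continuousOn_tsum
    (fun n => (continuousOn_powerKernelTerm s n).mono fun y hy => (half_pos hx).trans hy.1)
    (hasSum_powerKernel_bound (((x / 2) ^ (s.re - 1) + (2 * x) ^ (s.re - 1)) *
      powerKernelConst s) (2 * x)).summable
    (fun n y hy => norm_powerKernelTerm_le_of_mem_Ioo hs n (half_pos hx) hy)

/-- Each term integrates to `Γ(n+s) p^(-n-s)`, which cancels the Gamma factor and leaves the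
exponential series. The condition `p > 1` beats the factor `e^x` in the majorant of the series. -/
theorem laplace_powerKernel {s : ℂ} (hs : 0 < s.re) {p : ℝ} (hp : 1 < p) :
    ∫ x in Ioi (0 : ℝ), exp (-(p * x)) * powerKernel s x = (1 / p : ℂ) ^ s * exp (1 / p) := by
  have hp0 : 0 < p := by linarith
  have hint := (integrableOn_rpow_mul_exp_neg_mul hs (sub_pos.mpr hp)).const_mul
    (powerKernelConst s)
  have key := hasSum_integral_of_dominated_convergence (μ := volume.restrict (Ioi (0 : ℝ)))
    (F := fun n x => exp (-(p * x)) * powerKernelTerm s n x)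
    (f := fun x => exp (-(p * x)) * powerKernel s x)
    (fun n x => (Real.exp (-(p * x)) * (x ^ (s.re - 1) * powerKernelConst s)) *
      (x ^ n / n.factorial))
    (fun n => (ContinuousOn.mul (by fun_prop) (continuousOn_powerKernelTerm s n)).aestronglyMeasurable
      measurableSet_Ioi)
    (fun n => ae_restrict_of_forall_mem measurableSet_Ioi fun x hx => by
      rw [norm_mul, norm_exp, mul_assoc]
      simp only [neg_re, mul_re, ofReal_re, ofReal_im, mul_zero, sub_zero]
      exact mul_le_mul_of_nonneg_left (norm_powerKernelTerm_le hs n hx) (Real.exp_pos _).le)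
    (.of_forall fun x => (hasSum_powerKernel_bound _ x).summable)
    (by
      simp_rw [fun x : ℝ => (hasSum_powerKernel_bound (Real.exp (-(p * x)) *
        (x ^ (s.re - 1) * powerKernelConst s)) x).tsum_eq]
      refine hint.congr (.of_forall fun x => ?_)
      have : Real.exp (-((p - 1) * x)) = Real.exp (-(p * x)) * Real.exp x := by
        rw [← Real.exp_add]; ring_nf
      simp only [this]
      ring)
    (ae_restrict_of_forall_mem measurableSet_Ioi fun x hx =>
      (summable_powerKernelTerm hs hx).hasSum.mul_left _)
  have hval : ∀ n : ℕ, ∫ x in Ioi (0 : ℝ), exp (-(p * x)) * powerKernelTerm s n x =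
      (1 / p : ℂ) ^ s * ((1 / p : ℂ) ^ n / n.factorial) := by
    intro n
    have hns : 0 < (n + s).re := by
      simp
      have hm : (0 : ℝ) ≤ n := n.cast_nonneg
      linarith
    have h := integral_cpow_mul_exp_neg_mul_Ioi hns hp0
    have hG := Gamma_ne_zero_of_re_pos hns
    calc _ = ∫ x in Ioi (0 : ℝ), ((Gamma (n + s))⁻¹ / n.factorial) *
          ((x : ℂ) ^ (n + s - 1) * exp (-(p * x))) := by
          congr 1; funext x; rw [powerKernelTerm]; ring
      _ = _ := by
        rw [integral_const_mul, h, cpow_add _ _ (by simpa using hp0.ne'), cpow_natCast]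
        field_simp
  simp_rw [hval] at key
  refine key.unique (HasSum.mul_left _ ?_)
  rw [Complex.exp_eq_exp_ℂ]
  exact NormedSpace.expSeries_div_hasSum_exp (1 / p : ℂ)

/-- Joint measurability for Fubini: the partial sums are measurable because `1/Γ` is entire. -/
theorem aestronglyMeasurable_powerKernel {γ : ℝ} (hγ : γ < 0) :
    AEStronglyMeasurable (fun q : ℝ × ℝ => powerKernel (-(γ + q.2 * I)) q.1)
      ((volume.restrict (Ioi (0 : ℝ))).prod volume) := by
  refine AEMeasurable.aestronglyMeasurable ?_
  refine aemeasurable_of_tendsto_metrizable_ae Filter.atTop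
    (f := fun (N : ℕ) q => ∑ n ∈ Finset.range N, powerKernelTerm (-(γ + q.2 * I)) n q.1) ?_ ?_
  · intro N
    refine (Finset.measurable_sum _ fun n _ => ?_).aemeasurable
    unfold powerKernelTerm
    have hG : Measurable fun s : ℂ => (Gamma s)⁻¹ := differentiable_one_div_Gamma.continuous.measurable
    refine Measurable.div_const (Measurable.mul ?_ (hG.comp (by fun_prop))) _
    fun_prop
  · have h : ∀ᵐ q : ℝ × ℝ ∂((volume.restrict (Ioi (0 : ℝ))).prod volume), q.1 ∈ Ioi (0 : ℝ) :=
      Measure.quasiMeasurePreserving_fst.ae (ae_restrict_mem measurableSet_Ioi)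
    filter_upwards [h] with q hq
    exact (summable_powerKernelTerm (by simpa using hγ) hq).hasSum.tendsto_sum_nat

/-! ### Analyticity and uniqueness of the Laplace transform. -/

/-- Integrability at real points passes to complex ones because `|e^(-px)|` depends only on `Re p`.
For `a < r < q < Re p`, the factor `x` from differentiation is absorbed by `x e^(-qx) ≤ (q-r)⁻¹
e^(-rx)`. -/
theorem hasDerivAt_laplace {d : ℝ → ℂ} {a : ℝ}
    (hint : ∀ p : ℝ, a < p → IntegrableOn (fun x : ℝ => exp (-(p * x)) * d x) (Ioi 0))
    {p : ℂ} (hp : a < p.re) :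
    IntegrableOn (fun x : ℝ => exp (-(p * x)) * d x) (Ioi 0) ∧
    HasDerivAt (fun p : ℂ => ∫ x in Ioi (0 : ℝ), exp (-(p * x)) * d x)
      (∫ x in Ioi (0 : ℝ), -x * exp (-(p * x)) * d x) p := by
  obtain ⟨q, hq, hqp⟩ := exists_between hp
  obtain ⟨r, hr, hrq⟩ := exists_between hq
  have hmeas : ∀ p' : ℂ, AEStronglyMeasurable (fun x : ℝ => exp (-(p' * x)) * d x)
      (volume.restrict (Ioi 0)) := fun p' => by
    have h := (hint r hr).aestronglyMeasurable
    have h2 : Continuous fun x : ℝ => exp (-((p' - r) * x)) := by fun_prop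
    refine (h2.aestronglyMeasurable.mul h).congr (.of_forall fun x => ?_)
    simp only [Pi.mul_apply]
    rw [← mul_assoc, ← exp_add]
    ring_nf
  have hI : ∀ {p' : ℂ}, a < p'.re →
      IntegrableOn (fun x : ℝ => exp (-(p' * x)) * d x) (Ioi 0) := fun {p'} hp' => by
    refine (hint _ hp').congr' (hmeas p') (.of_forall fun x => ?_)
    simp [norm_exp]
  refine ⟨hI hp, ?_⟩
  refine (hasDerivAt_integral_of_dominated_loc_of_deriv_le (𝕜 := ℂ)
    (μ := volume.restrict (Ioi (0 : ℝ))) (s := {w : ℂ | q < w.re})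
    (F := fun p x => exp (-(p * x)) * d x) (F' := fun p x => -x * exp (-(p * x)) * d x)
    (bound := fun x => (q - r)⁻¹ * ‖exp (-(r * x)) * d x‖)
    ((isOpen_lt continuous_const continuous_re).mem_nhds hqp) (.of_forall hmeas) (hI hp)
    ?_ ?_ ((hint r hr).norm.const_mul _) ?_).2
  · have h2 : Continuous fun x : ℝ => -(x : ℂ) := by fun_prop
    refine (h2.aestronglyMeasurable.mul (hmeas p)).congr (.of_forall fun x => ?_)
    simp only [Pi.mul_apply]
    ring
  · refine ae_restrict_of_forall_mem measurableSet_Ioi fun x hx w hw => ?_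
    have hx' : (0 : ℝ) < x := hx
    have hw' : q < w.re := hw
    have hqr : 0 < q - r := sub_pos.mpr hrq
    simp only [norm_mul, norm_neg, norm_real, norm_exp, Real.norm_of_nonneg hx'.le, neg_re, mul_re,
      ofReal_re, ofReal_im, mul_zero, sub_zero]
    rw [← mul_assoc]
    refine mul_le_mul_of_nonneg_right ?_ (norm_nonneg _)
    have h1 : (q - r) * x ≤ Real.exp ((q - r) * x) :=
      (Real.add_one_le_exp _).trans' (by linarith)
    calc x * Real.exp (-(w.re * x)) ≤ ((q - r)⁻¹ * Real.exp ((q - r) * x)) * Real.exp (-(q * x)) := by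
          gcongr
          rw [inv_mul_eq_div, le_div_iff₀ hqr]
          linarith
      _ = _ := by
        rw [mul_assoc, ← Real.exp_add]
        ring_nf
  · refine .of_forall fun x w _ => ?_
    have h : HasDerivAt (fun w : ℂ => -(w * x)) (-x) w := by
      simpa using ((hasDerivAt_id w).mul_const (x : ℂ)).fun_neg
    have h2 := h.cexp.mul_const (d x)
    rwa [mul_comm (exp _)] at h2

/-- A continuous function on the half-line whose Laplace transform vanishes is zero. -/
theorem eq_zero_of_laplace_eq_zero {d : ℝ → ℂ} {a : ℝ} (hd : ∀ x, 0 < x → ContinuousAt d x)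
    (hint : ∀ p : ℝ, a < p → IntegrableOn (fun x : ℝ => exp (-(p * x)) * d x) (Ioi 0))
    (h0 : ∀ p : ℝ, a < p → ∫ x in Ioi (0 : ℝ), exp (-(p * x)) * d x = 0) {x : ℝ} (hx : 0 < x) :
    d x = 0 := by
  -- The identity theorem spreads the vanishing from the real ray to the half-plane. On the line `Re
  -- w = a + 1` the transform is the Fourier transform of the integrable function `e^(-(a+1)x)
  -- d(x)`, and Fourier inversion at a point of continuity finishes.
  set U : Set ℂ := {w : ℂ | a < w.re}
  have hU : IsOpen U := isOpen_lt continuous_const continuous_re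
  have hz : ∀ w ∈ U, ∫ x in Ioi (0 : ℝ), exp (-(w * x)) * d x = 0 := by
    have hana : AnalyticOnNhd ℂ (fun p : ℂ => ∫ x in Ioi (0 : ℝ), exp (-(p * x)) * d x) U :=
      DifferentiableOn.analyticOnNhd
        (fun w hw => (hasDerivAt_laplace hint hw).2.differentiableAt.differentiableWithinAt) hU
    have hmem : ((a + 1 : ℝ) : ℂ) ∈ U := by simp [U]
    refine fun w hw => hana.eqOn_zero_of_preconnected_of_frequently_eq_zero
      (convex_halfSpace_re_gt a).isPreconnected hmem ?_ hw
    have ht : Filter.Tendsto (fun t : ℝ => (t : ℂ)) (nhdsWithin (a + 1) {a + 1}ᶜ)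
        (nhdsWithin ((a + 1 : ℝ) : ℂ) {((a + 1 : ℝ) : ℂ)}ᶜ) :=
      continuous_ofReal.continuousWithinAt.tendsto_nhdsWithin fun t ht => by
        simpa [← ofReal_one, ← ofReal_add, -ofReal_inj] using fun h => ht (ofReal_injective h)
    refine ht.frequently (Filter.Eventually.frequently ?_)
    filter_upwards [mem_nhdsWithin_of_mem_nhds (lt_mem_nhds (lt_add_one a))] with t ht'
    exact h0 t ht'
  set φ : ℝ → ℂ := (Ioi 0).indicator fun x : ℝ => exp (-((a + 1 : ℝ) * x)) * d x with hφ
  have hφi : Integrable φ := (integrable_indicator_iff measurableSet_Ioi).mpr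
    (hint _ (lt_add_one a))
  have hF : FourierTransform.fourier φ = 0 := by
    funext w
    rw [Real.fourier_real_eq_integral_exp_smul]
    have e : (fun v : ℝ => exp (↑(-2 * Real.pi * v * w) * I) • φ v) =
        (Ioi 0).indicator fun v : ℝ => exp (-(((a + 1 : ℝ) + 2 * Real.pi * w * I) * v)) * d v := by
      funext v
      by_cases hv : v ∈ Ioi (0 : ℝ)
      · rw [hφ, indicator_of_mem hv, indicator_of_mem hv, smul_eq_mul, ← mul_assoc, ← exp_add]
        push_cast
        ring_nf
      · rw [hφ, indicator_of_notMem hv, indicator_of_notMem hv, smul_zero]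
    rw [e, integral_indicator measurableSet_Ioi, hz _ (by simp [U])]
    rfl
  have heq : φ =ᶠ[nhds x] fun x : ℝ => exp (-((a + 1 : ℝ) * x)) * d x := by
    filter_upwards [Ioi_mem_nhds hx] with y hy
    rw [hφ, indicator_of_mem hy]
  have hcont : ContinuousAt φ x := by
    refine ContinuousAt.congr ?_ heq.symm
    exact ContinuousAt.mul (by fun_prop) (hd x hx)
  have h := hφi.fourierInv_fourier_eq (by rw [hF]; exact integrable_zero _ _ _) hcont
  rw [hF, heq.eq_of_nhds] at h
  have h' : (0 : ℂ) = exp (-((a + 1 : ℝ) * x)) * d x := by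
    rw [← h, Real.fourierInv_eq]
    simp
  simpa using h'.symm

/-! ### Size and continuity of inverse Mellin integrals. -/

theorem norm_mellinInv_le {σ x : ℝ} (hx : 0 < x) (F : ℂ → ℂ) :
    ‖mellinInv σ F x‖ ≤ (1 / (2 * Real.pi) * ∫ y : ℝ, ‖F (σ + y * I)‖) * x ^ (-σ) := by
  have hpi := Real.pi_pos
  rw [mellinInv, norm_smul, Real.norm_of_nonneg (by positivity), mul_assoc, ← integral_mul_const]
  refine mul_le_mul_of_nonneg_left ((norm_integral_le_integral_norm _).trans_eq ?_) (by positivity)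
  congr 1
  funext y
  rw [norm_smul, norm_cpow_eq_rpow_re_of_pos hx, mul_comm]
  simp

theorem continuousAt_mellinInv {σ x : ℝ} (hx : 0 < x) {F : ℂ → ℂ} (hF : VerticalIntegrable F σ) :
    ContinuousAt (mellinInv σ F) x := by
  unfold mellinInv
  refine ContinuousAt.const_smul ?_ _
  have hev : ∀ᶠ y in nhds x, y ∈ Ioo (x / 2) (2 * x) :=
    Ioo_mem_nhds (by linarith) (by linarith)
  refine continuousAt_of_dominated
    (bound := fun τ : ℝ => ((x / 2) ^ (-σ) + (2 * x) ^ (-σ)) * ‖F (σ + τ * I)‖) ?_ ?_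
    (Integrable.const_mul (Integrable.norm hF) _) ?_
  · filter_upwards [hev] with y hy
    have hy0 : (y : ℂ) ≠ 0 := ofReal_ne_zero.mpr ((half_pos hx).trans hy.1).ne'
    have hc : Continuous fun τ : ℝ => (y : ℂ) ^ (-(σ + τ * I) : ℂ) :=
      Continuous.const_cpow (by fun_prop) (Or.inl hy0)
    exact hc.aestronglyMeasurable.smul hF.aestronglyMeasurable
  · filter_upwards [hev] with y hy
    refine .of_forall fun τ => ?_
    have hy0 := (half_pos hx).trans hy.1
    rw [norm_smul, norm_cpow_eq_rpow_re_of_pos hy0]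
    refine mul_le_mul_of_nonneg_right ?_ (norm_nonneg _)
    simpa using rpow_le_add_of_mem_Ioo (r := -σ) (half_pos hx) hy
  · refine .of_forall fun τ => ?_
    exact (continuousAt_ofReal_cpow_const x _ (Or.inr hx.ne')).smul continuousAt_const

/-! ### The index transform as a Mellin transform. -/

/-- The function `e^(-t) ∫₀^∞ e^(-x/t) f(x) dx`, whose Mellin transform is `Ff`. -/
noncomputable def laplaceProfile (f : ℝ → ℂ) (t : ℝ) : ℂ :=
  exp (-t) * ∫ x in Ioi (0 : ℝ), exp (-((1 / t : ℝ) * x)) * f x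

section

variable {f : ℝ → ℂ} {c C : ℝ}

theorem aestronglyMeasurable_of_continuousAt (hf : ∀ x, 0 < x → ContinuousAt f x) :
    AEStronglyMeasurable f (volume.restrict (Ioi 0)) :=
  ContinuousOn.aestronglyMeasurable (fun x hx => (hf x hx).continuousWithinAt) measurableSet_Ioi

theorem integrableOn_exp_mul (hf : ∀ x, 0 < x → ContinuousAt f x)
    (hC : ∀ x, 0 < x → ‖f x‖ ≤ C * x ^ (-c)) (hc : c < 1) {p : ℝ} (hp : 0 < p) :
    IntegrableOn (fun x : ℝ => exp (-(p * x)) * f x) (Ioi 0) := by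
  refine Integrable.mono' ((integrableOn_rpow_mul_exp_neg_mul (sub_pos.mpr hc) hp).const_mul C)
    (AEStronglyMeasurable.mul (Continuous.aestronglyMeasurable (by fun_prop))
      (aestronglyMeasurable_of_continuousAt hf))
    (ae_restrict_of_forall_mem measurableSet_Ioi fun x hx => ?_)
  rw [norm_mul, norm_exp, show 1 - c - 1 = -c by ring]
  have := mul_le_mul_of_nonneg_left (hC x hx) (Real.exp_pos (-(p * x))).le
  simp only [neg_re, mul_re, ofReal_re, ofReal_im, mul_zero, sub_zero]
  linarith

/-- Needed for pointwise Mellin inversion; it follows from the differentiability of the Laplace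
transform. -/
theorem continuousAt_laplaceProfile (hf : ∀ x, 0 < x → ContinuousAt f x)
    (hC : ∀ x, 0 < x → ‖f x‖ ≤ C * x ^ (-c)) (hc : c < 1) {t : ℝ} (ht : 0 < t) :
    ContinuousAt (laplaceProfile f) t := by
  unfold laplaceProfile
  refine ContinuousAt.mul (by fun_prop) ?_
  have h := (hasDerivAt_laplace (a := 0) (p := ((1 / t : ℝ) : ℂ))
    (fun p hp => integrableOn_exp_mul hf hC hc hp)
    (by rw [ofReal_re]; positivity)).2.continuousAt
  exact ContinuousAt.comp (f := fun t : ℝ => ((1 / t : ℝ) : ℂ)) h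
    (continuous_ofReal.continuousAt.comp (continuousAt_const.div continuousAt_id ht.ne'))

/-- With `|f(x)| ≤ C x^(-c)`, the `x`-integral of the majorant is a multiple of `Γ(1-c) t^(1-c)`,
which needs `c < 1`. What remains is a Gamma integral in `t` with exponent `Re z + 1 - c`, positive
exactly when `c - 1 < Re z`. -/
theorem integrable_prod_transform (hf : ∀ x, 0 < x → ContinuousAt f x)
    (hC : ∀ x, 0 < x → ‖f x‖ ≤ C * x ^ (-c)) (hc : c < 1) {z : ℂ} (hz : c - 1 < z.re) :
    Integrable (fun q : ℝ × ℝ => ((Real.exp (-q.2 - q.1 / q.2) : ℝ) : ℂ) * (q.2 : ℂ) ^ (z - 1) *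
      f q.1) ((volume.restrict (Ioi 0)).prod (volume.restrict (Ioi 0))) := by
  have hbound : Integrable (fun q : ℝ × ℝ => (C * (Real.exp (-q.2) * q.2 ^ (z.re - 1))) *
      (q.1 ^ (1 - c - 1) * Real.exp (-(1 / q.2 * q.1))))
      ((volume.restrict (Ioi 0)).prod (volume.restrict (Ioi 0))) := by
    have hC0 : 0 ≤ C := by simpa using (norm_nonneg _).trans (hC 1 one_pos)
    rw [integrable_prod_iff' (Measurable.aestronglyMeasurable (by fun_prop))]
    refine ⟨ae_restrict_of_forall_mem measurableSet_Ioi fun t ht =>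
      (integrableOn_rpow_mul_exp_neg_mul (sub_pos.mpr hc) (one_div_pos.mpr ht)).const_mul
        (C * (Real.exp (-t) * t ^ (z.re - 1))), ?_⟩
    have hI : IntegrableOn (fun t : ℝ => C * Real.Gamma (1 - c) *
        (t ^ (z.re + (1 - c) - 1) * Real.exp (-(1 * t)))) (Ioi 0) :=
      (integrableOn_rpow_mul_exp_neg_mul (by linarith) one_pos).const_mul _
    refine hI.congr (ae_restrict_of_forall_mem measurableSet_Ioi fun t ht => ?_)
    have ht' : (0 : ℝ) < t := ht
    have e : ∫ x in Ioi (0 : ℝ), ‖(C * (Real.exp (-t) * t ^ (z.re - 1))) *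
        (x ^ (1 - c - 1) * Real.exp (-(1 / t * x)))‖ = ∫ x in Ioi (0 : ℝ),
        (C * (Real.exp (-t) * t ^ (z.re - 1))) * (x ^ (1 - c - 1) * Real.exp (-(1 / t * x))) :=
      setIntegral_congr_fun measurableSet_Ioi fun x hx => by
        have hx' : (0 : ℝ) < x := hx
        exact Real.norm_of_nonneg (by positivity)
    simp only [e]
    rw [integral_const_mul, Real.integral_rpow_mul_exp_neg_mul_Ioi (sub_pos.mpr hc)
      (one_div_pos.mpr ht'), one_div_one_div, show z.re + (1 - c) - 1 = (z.re - 1) + (1 - c) by ring,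
      Real.rpow_add ht', one_mul]
    ring
  refine hbound.mono' ?_ ?_
  · exact AEStronglyMeasurable.mul (Measurable.aestronglyMeasurable (by fun_prop))
      (aestronglyMeasurable_of_continuousAt hf).comp_fst
  · have h1 : ∀ᵐ q : ℝ × ℝ ∂((volume.restrict (Ioi (0 : ℝ))).prod (volume.restrict (Ioi 0))),
        q.1 ∈ Ioi (0 : ℝ) :=
      Measure.quasiMeasurePreserving_fst.ae (ae_restrict_mem measurableSet_Ioi)
    have h2 : ∀ᵐ q : ℝ × ℝ ∂((volume.restrict (Ioi (0 : ℝ))).prod (volume.restrict (Ioi 0))),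
        q.2 ∈ Ioi (0 : ℝ) :=
      Measure.quasiMeasurePreserving_snd.ae (ae_restrict_mem measurableSet_Ioi)
    filter_upwards [h1, h2] with q hq1 hq2
    have hq2' : (0 : ℝ) < q.2 := hq2
    rw [norm_mul, norm_mul, norm_cpow_eq_rpow_re_of_pos hq2', norm_real,
      Real.norm_of_nonneg (Real.exp_pos _).le, sub_eq_add_neg (-q.2), Real.exp_add, sub_re, one_re,
      show 1 - c - 1 = -c by ring, one_div_mul_eq_div]
    have := mul_le_mul_of_nonneg_left (hC q.1 hq1)
      (by positivity : 0 ≤ Real.exp (-q.2) * Real.exp (-(q.1 / q.2)) * q.2 ^ (z.re - 1))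
    linarith

/-- The prefactor `(√x)^(-z)` in the integral for `K_z(2√x)` cancels `x^(z/2)`. -/
theorem indexIntegrand_eq_integral {x : ℝ} (hx : 0 < x) (z : ℂ) :
    indexIntegrand f z x = 1 / 2 * ∫ t in Ioi (0 : ℝ),
      ((Real.exp (-t - x / t) : ℝ) : ℂ) * (t : ℂ) ^ (z - 1) * f x := by
  have h1 : ((2 * √x / 2 : ℝ) : ℂ) ≠ 0 := by
    rw [ofReal_ne_zero]
    have := Real.sqrt_pos.mpr hx
    positivity
  have h2 : (x : ℂ) ≠ 0 := ofReal_ne_zero.mpr hx.ne'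
  have h3 : (x : ℂ) ^ (z / 2) * ((2 * √x / 2 : ℝ) : ℂ) ^ (-z) = 1 := by
    rw [cpow_def_of_ne_zero h1, cpow_def_of_ne_zero h2, ← exp_add,
      ← ofReal_log hx.le, ← ofReal_log (x := 2 * √x / 2) (by positivity), mul_div_cancel_left₀ _ two_ne_zero,
      Real.log_sqrt hx.le, ← Complex.exp_zero]
    congr 1
    push_cast
    ring
  have h4 : ∀ t : ℝ, (2 * √x) ^ 2 / (4 * t) = x / t := fun t => by
    rw [mul_pow, Real.sq_sqrt hx.le]
    norm_num
    exact mul_div_mul_left _ _ four_ne_zero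
  simp_rw [indexIntegrand, besselK, h4]
  rw [integral_mul_const]
  linear_combination (1 / 2 * (∫ t in Ioi (0 : ℝ),
      ((Real.exp (-t - x / t) : ℝ) : ℂ) * (t : ℂ) ^ (z - 1)) * f x) * h3

theorem integrableOn_indexIntegrand (hf : ∀ x, 0 < x → ContinuousAt f x)
    (hC : ∀ x, 0 < x → ‖f x‖ ≤ C * x ^ (-c)) (hc : c < 1) {z : ℂ} (hz : c - 1 < z.re) :
    IntegrableOn (indexIntegrand f z) (Ioi 0) :=
  ((integrable_prod_transform hf hC hc hz).integral_prod_left.const_mul (1 / 2)).congr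
    (ae_restrict_of_forall_mem measurableSet_Ioi fun _ hx => (indexIntegrand_eq_integral hx z).symm)

theorem integral_transform_kernel (z : ℂ) (t : ℝ) :
    ∫ x in Ioi (0 : ℝ), ((Real.exp (-t - x / t) : ℝ) : ℂ) * (t : ℂ) ^ (z - 1) * f x =
      (t : ℂ) ^ (z - 1) • laplaceProfile f t := by
  rw [laplaceProfile, smul_eq_mul, ← mul_assoc, ← integral_const_mul]
  congr 1
  funext x
  have : ((Real.exp (-t - x / t) : ℝ) : ℂ) = exp (-t) * exp (-((1 / t : ℝ) * x)) := by
    rw [← exp_add]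
    push_cast
    ring_nf
  rw [this]
  ring

theorem indexTransform_eq_mellin (hf : ∀ x, 0 < x → ContinuousAt f x)
    (hC : ∀ x, 0 < x → ‖f x‖ ≤ C * x ^ (-c)) (hc : c < 1) {z : ℂ} (hz : c - 1 < z.re) :
    indexTransform f z = mellin (laplaceProfile f) z := by
  rw [indexTransform, setIntegral_congr_fun measurableSet_Ioi
    (fun x hx => indexIntegrand_eq_integral hx z), integral_const_mul, ← mul_assoc, mul_one_div,
    div_self two_ne_zero, one_mul, integral_integral_swap (integrable_prod_transform hf hC hc hz),
    mellin]
  simp_rw [integral_transform_kernel]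

theorem mellinConvergent_laplaceProfile (hf : ∀ x, 0 < x → ContinuousAt f x)
    (hC : ∀ x, 0 < x → ‖f x‖ ≤ C * x ^ (-c)) (hc : c < 1) {z : ℂ} (hz : c - 1 < z.re) :
    MellinConvergent (laplaceProfile f) z := by
  have h := (integrable_prod_transform hf hC hc hz).integral_prod_right
  simp_rw [integral_transform_kernel] at h
  exact h

end

/-! ### Absolute convergence and differentiation of the inversion integral. -/

theorem continuous_mellin_vertical {g : ℝ → ℂ} {γ : ℝ} (hg : MellinConvergent g γ) :
    Continuous fun τ : ℝ => mellin g (γ + τ * I) := by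
  unfold mellin
  have hn : ∀ τ : ℝ, ∀ t : ℝ, 0 < t → ‖(t : ℂ) ^ (γ + τ * I - 1 : ℂ) • g t‖ =
      ‖(t : ℂ) ^ (γ - 1 : ℂ) • g t‖ := fun τ t ht => by
    rw [norm_smul, norm_smul, norm_cpow_eq_rpow_re_of_pos ht, norm_cpow_eq_rpow_re_of_pos ht]
    simp
  refine continuous_of_dominated (bound := fun t => ‖(t : ℂ) ^ (γ - 1 : ℂ) • g t‖) ?_ ?_
    (Integrable.norm hg) ?_
  · intro τ
    have h1 : AEStronglyMeasurable (fun t : ℝ => (t : ℂ) ^ (τ * I : ℂ))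
        (volume.restrict (Ioi 0)) := Measurable.aestronglyMeasurable (by fun_prop)
    refine (h1.mul hg.aestronglyMeasurable).congr
      (ae_restrict_of_forall_mem measurableSet_Ioi fun t ht => ?_)
    have ht0 : (t : ℂ) ≠ 0 := ofReal_ne_zero.mpr (ne_of_gt ht)
    simp only [Pi.mul_apply, smul_eq_mul]
    rw [← mul_assoc, ← cpow_add _ _ ht0]
    ring_nf
  · exact fun τ => ae_restrict_of_forall_mem measurableSet_Ioi fun t ht => (hn τ t ht).le
  · refine ae_restrict_of_forall_mem measurableSet_Ioi fun t ht => ?_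
    have ht0 : (t : ℂ) ≠ 0 := ofReal_ne_zero.mpr (ne_of_gt ht)
    exact (Continuous.const_cpow (by fun_prop) (Or.inl ht0)).smul continuous_const

theorem measurable_powerKernel_comp {s : ℝ → ℂ} (hs : Measurable s) (hre : ∀ τ, 0 < (s τ).re)
    {x : ℝ} (hx : 0 < x) : Measurable fun τ => powerKernel (s τ) x := by
  refine measurable_of_tendsto_metrizable
    (f := fun (N : ℕ) τ => ∑ n ∈ Finset.range N, powerKernelTerm (s τ) n x) (fun N => ?_) ?_
  · refine Finset.measurable_sum _ fun n _ => ?_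
    unfold powerKernelTerm
    have hG : Measurable fun s : ℂ => (Gamma s)⁻¹ := differentiable_one_div_Gamma.continuous.measurable
    refine Measurable.div_const (Measurable.mul (by fun_prop) (hG.comp (by fun_prop))) _
  · rw [tendsto_pi_nhds]
    exact fun τ => (summable_powerKernelTerm (hre τ) hx).hasSum.tendsto_sum_nat

/-- Lets the majorant for the kernel with `s = -z` serve also for the kernel with `s = 1 - z`. -/
theorem powerKernelConst_one_add_le {s : ℂ} (hs : 0 < s.re) :
    powerKernelConst (1 + s) ≤ powerKernelConst s := by
  have hΓ : 0 < ‖Gamma s‖ := norm_pos_iff.mpr (Gamma_ne_zero_of_re_pos hs)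
  have hm : 0 < min 1 s.re := lt_min one_pos hs
  unfold powerKernelConst
  refine inv_anti₀ (mul_pos hm hΓ) ?_
  have h := le_norm_Gamma_natCast_add hs 1
  have h1 : min 1 (1 + s).re = 1 := min_eq_left (by simp; linarith)
  rw [h1, one_mul]
  simpa using h

section

variable {f : ℝ → ℂ} {c C γ : ℝ}

/-- The majorant of the inversion integrand on the line `Re z = γ`. -/
noncomputable def transformWeight (f : ℝ → ℂ) (γ τ : ℝ) : ℝ :=
  powerKernelConst (-(γ + τ * I)) * ‖indexTransform f (γ + τ * I)‖

theorem continuous_indexTransform_vertical (hf : ∀ x, 0 < x → ContinuousAt f x)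
    (hC : ∀ x, 0 < x → ‖f x‖ ≤ C * x ^ (-c)) (hc : c < 1) (hγ : c - 1 < γ) :
    Continuous fun τ : ℝ => indexTransform f (γ + τ * I) := by
  have h := continuous_mellin_vertical
    (mellinConvergent_laplaceProfile hf hC hc (z := (γ : ℂ)) (by simpa using hγ))
  refine h.congr fun τ => (indexTransform_eq_mellin hf hC hc ?_).symm
  simpa using hγ

/-- For `|τ| > 1` the Gamma bound with `a = -γ` reproduces the assumed weight `|τ|^(γ+1/2)
e^(π|τ|/2)`; for `|τ| ≤ 1` continuity on a compact interval suffices. -/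
theorem integrable_transformWeight (hf : ∀ x, 0 < x → ContinuousAt f x)
    (hC : ∀ x, 0 < x → ‖f x‖ ≤ C * x ^ (-c)) (hc : c < 1) (hγ : c - 1 < γ) (hγ0 : γ < 0)
    (hF : ExpIntegrableTransform f γ) : Integrable (transformWeight f γ) := by
  have hm : 0 < min 1 (-γ) := lt_min one_pos (by linarith)
  have hre : ∀ τ : ℝ, (-(γ + τ * I) : ℂ).re = -γ := fun τ => by simp
  have hcont : Continuous (transformWeight f γ) := by
    have h1 := (continuous_indexTransform_vertical hf hC hc hγ).norm
    have h2 : Continuous fun τ : ℝ => ‖(Gamma (-(γ + τ * I)))⁻¹‖ :=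
      (differentiable_one_div_Gamma.continuous.comp
        (by fun_prop : Continuous fun τ : ℝ => (-(γ + τ * I) : ℂ))).norm
    refine ((h2.const_mul (min 1 (-γ))⁻¹).mul h1).congr fun τ => ?_
    rw [Pi.mul_apply, transformWeight, powerKernelConst, hre, mul_inv, norm_inv]
  have hS : MeasurableSet {τ : ℝ | 1 < |τ|} := (isOpen_lt continuous_const continuous_abs).measurableSet
  rw [← integrableOn_univ, ← union_compl_self {τ : ℝ | 1 < |τ|}]
  refine IntegrableOn.union ?_ ?_
  · refine Integrable.mono' (Integrable.const_mul (Integrable.norm hF)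
      ((min 1 (-γ))⁻¹ * (4 * √(2 * Real.pi) / Real.pi))) hcont.aestronglyMeasurable
      (ae_restrict_of_forall_mem hS fun τ hτ => ?_)
    have hτ' : 1 ≤ |τ| := le_of_lt hτ
    have h := inv_norm_Gamma_le (a := -γ) (τ := -τ) (by linarith) (by simpa using hτ')
    have e : ((-γ : ℝ) + (-τ : ℝ) * I : ℂ) = -(γ + τ * I) := by push_cast; ring
    rw [e, abs_neg, show 1 / 2 - -γ = γ + 1 / 2 by ring] at h
    have hpos : 0 ≤ |τ| ^ (γ + 1 / 2) * Real.exp (Real.pi * |τ| / 2) := by positivity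
    rw [norm_mul, norm_real, Real.norm_of_nonneg hpos, transformWeight, powerKernelConst, hre,
      mul_inv, Real.norm_of_nonneg (by positivity)]
    calc _ ≤ (min 1 (-γ))⁻¹ * (4 * √(2 * Real.pi) / Real.pi *
          (|τ| ^ (γ + 1 / 2) * Real.exp (Real.pi * |τ| / 2))) *
          ‖indexTransform f (γ + τ * I)‖ := by gcongr
      _ = _ := by ring
  · refine (hcont.continuousOn.integrableOn_compact (isCompact_Icc (a := (-1 : ℝ)) (b := 1))).mono_set ?_
    intro τ hτ
    have : ¬ 1 < |τ| := hτ
    exact abs_le.mp (not_lt.mp this)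

theorem norm_powerKernel_mul_le (hγ0 : γ < 0) (τ : ℝ) {x : ℝ} (hx : 0 < x) :
    ‖powerKernel (-(γ + τ * I)) x * indexTransform f (γ + τ * I)‖ ≤
      x ^ (-γ - 1) * Real.exp x * transformWeight f γ τ := by
  have hre : (-(γ + τ * I) : ℂ).re = -γ := by simp
  have h := norm_powerKernel_le (s := -(γ + τ * I)) (by rw [hre]; linarith) hx
  rw [hre] at h
  rw [norm_mul, transformWeight]
  calc _ ≤ _ := mul_le_mul_of_nonneg_right h (norm_nonneg _)
    _ = _ := by ring

theorem norm_powerKernel_mul_le_of_mem_Ioo (hγ0 : γ < 0) (τ : ℝ) {a b y : ℝ} (ha : 0 < a)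
    (hy : y ∈ Ioo a b) :
    ‖powerKernel (-(γ + τ * I)) y * indexTransform f (γ + τ * I)‖ ≤
      (a ^ (-γ - 1) + b ^ (-γ - 1)) * Real.exp b * transformWeight f γ τ := by
  refine (norm_powerKernel_mul_le hγ0 τ (ha.trans hy.1)).trans ?_
  have h1 := rpow_le_add_of_mem_Ioo (r := -γ - 1) ha hy
  have h2 := Real.exp_le_exp.mpr hy.2.le
  have h3 : 0 ≤ transformWeight f γ τ :=
    mul_nonneg (powerKernelConst_nonneg (by simpa using hγ0)) (norm_nonneg _)
  have h4 := Real.rpow_nonneg (ha.trans hy.1).le (-γ - 1)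
  exact mul_le_mul_of_nonneg_right (mul_le_mul h1 h2 (Real.exp_pos _).le (h4.trans h1)) h3

theorem norm_powerKernel_one_sub_mul_le (hγ0 : γ < 0) (τ : ℝ) {x : ℝ} (hx : 0 < x) :
    ‖powerKernel (1 - (γ + τ * I)) x * indexTransform f (γ + τ * I)‖ ≤
      x ^ (-γ) * Real.exp x * transformWeight f γ τ := by
  have hre : (1 - (γ + τ * I) : ℂ).re = 1 - γ := by simp
  have h := norm_powerKernel_le (s := 1 - (γ + τ * I)) (by rw [hre]; linarith) hx
  have h2 := powerKernelConst_one_add_le (s := -(γ + τ * I)) (by simpa using hγ0)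
  rw [← sub_eq_add_neg] at h2
  rw [hre, show 1 - γ - 1 = -γ by ring] at h
  rw [norm_mul, transformWeight]
  calc _ ≤ x ^ (-γ) * powerKernelConst (-(γ + τ * I)) * Real.exp x *
        ‖indexTransform f (γ + τ * I)‖ := by
        refine mul_le_mul_of_nonneg_right (h.trans ?_) (norm_nonneg _)
        gcongr
    _ = _ := by ring

theorem aestronglyMeasurable_powerKernel_mul (hγ0 : γ < 0)
    (hm : Continuous fun τ : ℝ => indexTransform f (γ + τ * I)) {x : ℝ} (hx : 0 < x) :
    AEStronglyMeasurable
      (fun τ : ℝ => powerKernel (-(γ + τ * I)) x * indexTransform f (γ + τ * I)) :=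
  ((measurable_powerKernel_comp (by fun_prop) (fun τ => by simpa using hγ0) hx).mul
    hm.measurable).aestronglyMeasurable

theorem integrable_powerKernel_mul (hγ0 : γ < 0)
    (hm : Continuous fun τ : ℝ => indexTransform f (γ + τ * I))
    (hW : Integrable (transformWeight f γ)) {x : ℝ} (hx : 0 < x) :
    Integrable (fun τ : ℝ => powerKernel (-(γ + τ * I)) x * indexTransform f (γ + τ * I)) :=
  (hW.const_mul _).mono' (aestronglyMeasurable_powerKernel_mul hγ0 hm hx)
    (.of_forall fun τ => norm_powerKernel_mul_le hγ0 τ hx)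

theorem integrable_powerKernel_one_sub_mul (hγ0 : γ < 0)
    (hm : Continuous fun τ : ℝ => indexTransform f (γ + τ * I))
    (hW : Integrable (transformWeight f γ)) {x : ℝ} (hx : 0 < x) :
    Integrable (fun τ : ℝ => powerKernel (1 - (γ + τ * I)) x * indexTransform f (γ + τ * I)) :=
  (hW.const_mul _).mono' ((measurable_powerKernel_comp (by fun_prop)
    (fun τ => by simp; linarith) hx).mul hm.measurable).aestronglyMeasurable
    (.of_forall fun τ => norm_powerKernel_one_sub_mul_le hγ0 τ hx)

theorem hasDerivAt_integral_powerKernel (hγ0 : γ < 0)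
    (hm : Continuous fun τ : ℝ => indexTransform f (γ + τ * I))
    (hW : Integrable (transformWeight f γ)) {x : ℝ} (hx : 0 < x) :
    HasDerivAt
      (fun y : ℝ => ∫ τ : ℝ, powerKernel (1 - (γ + τ * I)) y * indexTransform f (γ + τ * I))
      (∫ τ : ℝ, powerKernel (-(γ + τ * I)) x * indexTransform f (γ + τ * I)) x := by
  have hmem : Ioo (x / 2) (2 * x) ∈ nhds x := Ioo_mem_nhds (by linarith) (by linarith)
  refine (hasDerivAt_integral_of_dominated_loc_of_deriv_le hmem
    (F := fun y τ => powerKernel (1 - (γ + (τ : ℝ) * I)) y * indexTransform f (γ + τ * I))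
    (F' := fun y τ => powerKernel (-(γ + (τ : ℝ) * I)) y * indexTransform f (γ + τ * I))
    ?_ (integrable_powerKernel_one_sub_mul hγ0 hm hW hx)
    (aestronglyMeasurable_powerKernel_mul hγ0 hm hx)
    (.of_forall fun τ y hy => norm_powerKernel_mul_le_of_mem_Ioo hγ0 τ (half_pos hx) hy)
    (hW.const_mul _) (.of_forall fun τ y hy => ?_)).2
  · filter_upwards [Ioi_mem_nhds hx] with y hy
    exact (integrable_powerKernel_one_sub_mul hγ0 hm hW hy).aestronglyMeasurable
  · have h := hasDerivAt_powerKernel (s := -(γ + τ * I)) (by simpa using hγ0)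
      ((half_pos hx).trans hy.1)
    rw [show (-(γ + τ * I) + 1 : ℂ) = 1 - (γ + τ * I) by ring] at h
    exact h.mul_const _

theorem continuousAt_integral_powerKernel (hγ0 : γ < 0)
    (hm : Continuous fun τ : ℝ => indexTransform f (γ + τ * I))
    (hW : Integrable (transformWeight f γ)) {x : ℝ} (hx : 0 < x) :
    ContinuousAt
      (fun y : ℝ => ∫ τ : ℝ, powerKernel (-(γ + τ * I)) y * indexTransform f (γ + τ * I)) x := by
  have hmem : Ioo (x / 2) (2 * x) ∈ nhds x := Ioo_mem_nhds (by linarith) (by linarith)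
  refine continuousAt_of_dominated (bound := fun τ => ((x / 2) ^ (-γ - 1) + (2 * x) ^ (-γ - 1)) *
    Real.exp (2 * x) * transformWeight f γ τ) ?_ ?_ (hW.const_mul _) (.of_forall fun τ => ?_)
  · filter_upwards [Ioi_mem_nhds hx] with y hy
    exact aestronglyMeasurable_powerKernel_mul hγ0 hm hy
  · filter_upwards [hmem] with y hy
    exact .of_forall fun τ => norm_powerKernel_mul_le_of_mem_Ioo hγ0 τ (half_pos hx) hy
  · exact (continuousAt_powerKernel (by simpa using hγ0) hx).mul continuousAt_const

/-- The majorant separates into a function of `x` times `transformWeight`; its factor `e^x` turns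
`e^(-px)` into `e^(-(p-1)x)`, and `γ < 0` gives integrability at `0`. -/
theorem integrable_prod_laplace (hγ0 : γ < 0)
    (hm : Continuous fun τ : ℝ => indexTransform f (γ + τ * I))
    (hW : Integrable (transformWeight f γ)) {p : ℝ} (hp : 1 < p) :
    Integrable (fun q : ℝ × ℝ => exp (-(p * q.1)) *
      (powerKernel (-(γ + q.2 * I)) q.1 * indexTransform f (γ + q.2 * I)))
      ((volume.restrict (Ioi 0)).prod volume) := by
  have hb := (integrableOn_rpow_mul_exp_neg_mul (a := -γ) (by linarith) (sub_pos.mpr hp)).mul_prod hW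
  refine hb.mono' ?_ ?_
  · have h1 : Continuous fun q : ℝ × ℝ => exp (-(p * q.1)) := by fun_prop
    exact h1.aestronglyMeasurable.mul ((aestronglyMeasurable_powerKernel hγ0).mul
      (hm.comp continuous_snd).aestronglyMeasurable)
  · have h1 : ∀ᵐ q : ℝ × ℝ ∂((volume.restrict (Ioi (0 : ℝ))).prod volume), q.1 ∈ Ioi (0 : ℝ) :=
      Measure.quasiMeasurePreserving_fst.ae (ae_restrict_mem measurableSet_Ioi)
    filter_upwards [h1] with q hq
    have h := norm_powerKernel_mul_le (f := f) hγ0 q.2 hq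
    have e : ‖exp (-(p * q.1 : ℂ))‖ = Real.exp (-(p * q.1)) := by simp [norm_exp]
    have e2 : Real.exp (-((p - 1) * q.1)) = Real.exp (-(p * q.1)) * Real.exp q.1 := by
      rw [← Real.exp_add]; ring_nf
    rw [norm_mul, e, e2]
    have := mul_le_mul_of_nonneg_left h (Real.exp_pos (-(p * q.1))).le
    linarith

theorem laplace_integral_powerKernel (hγ0 : γ < 0)
    (hm : Continuous fun τ : ℝ => indexTransform f (γ + τ * I))
    (hW : Integrable (transformWeight f γ)) {p : ℝ} (hp : 1 < p) :
    ∫ x in Ioi (0 : ℝ), exp (-(p * x)) *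
      ∫ τ : ℝ, powerKernel (-(γ + τ * I)) x * indexTransform f (γ + τ * I) =
    exp (1 / p) * ∫ τ : ℝ, ((1 / p : ℝ) : ℂ) ^ (-(γ + τ * I) : ℂ) •
      indexTransform f (γ + τ * I) := by
  simp_rw [← integral_const_mul]
  rw [integral_integral_swap (integrable_prod_laplace hγ0 hm hW hp)]
  congr 1
  funext τ
  have h := laplace_powerKernel (s := -(γ + τ * I)) (by simpa using hγ0) hp
  simp_rw [← mul_assoc]
  rw [integral_mul_const, h, smul_eq_mul]
  push_cast
  ring

/-! ### The inversion formula, by comparison of Laplace transforms. -/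

/-- The inversion formula for the index transform `F`. -/
theorem index_inversion (hf : ∀ x, 0 < x → ContinuousAt f x)
    (hC : ∀ x, 0 < x → ‖f x‖ ≤ C * x ^ (-c)) (hc : c < 1) (hγ : c - 1 < γ) (hγ0 : γ < 0)
    (hF : ExpIntegrableTransform f γ) {x : ℝ} (hx : 0 < x) :
    f x = 1 / (2 * Real.pi) *
      ∫ τ : ℝ, powerKernel (-(γ + τ * I)) x * indexTransform f (γ + τ * I) := by
  have hm := continuous_indexTransform_vertical hf hC hc hγ
  have hW := integrable_transformWeight hf hC hc hγ hγ0 hF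
  have heq : ∀ τ : ℝ, indexTransform f (γ + τ * I) = mellin (laplaceProfile f) (γ + τ * I) :=
    fun τ => indexTransform_eq_mellin hf hC hc (by simpa using hγ)
  have hFint : VerticalIntegrable (mellin (laplaceProfile f)) γ := by
    -- Since `|Γ(-z)| ≤ Γ(-γ)` on the line, `powerKernelConst` is bounded below there, so
    -- integrability of the weighted transform yields that of `Ff` itself.
    have hn : min 1 (-γ) ≠ 0 := (lt_min one_pos (by linarith)).ne'
    refine (hW.const_mul (Real.Gamma (-γ) * min 1 (-γ))).mono'
      (hm.congr heq).aestronglyMeasurable (.of_forall fun τ => ?_)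
    have hre : (-(γ + τ * I) : ℂ).re = -γ := by simp
    have hre' : 0 < (-(γ + τ * I) : ℂ).re := by rw [hre]; linarith
    have hΓ := norm_Gamma_le_Gamma_re hre'
    have hΓ0 : 0 < ‖Gamma (-(γ + τ * I))‖ := norm_pos_iff.mpr (Gamma_ne_zero_of_re_pos hre')
    rw [hre] at hΓ
    rw [transformWeight, powerKernelConst, hre, ← heq]
    calc ‖indexTransform f (γ + τ * I)‖ ≤
          (Real.Gamma (-γ) / ‖Gamma (-(γ + τ * I))‖) * ‖indexTransform f (γ + τ * I)‖ :=
          le_mul_of_one_le_left (norm_nonneg _) ((one_le_div hΓ0).mpr hΓ)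
      _ = _ := by field_simp
  set G : ℝ → ℂ := fun x => 1 / (2 * Real.pi) *
    ∫ τ : ℝ, powerKernel (-(γ + τ * I)) x * indexTransform f (γ + τ * I) with hG
  have hfI : ∀ p : ℝ, 1 < p → IntegrableOn (fun x : ℝ => exp (-(p * x)) * f x) (Ioi 0) :=
    fun p hp => integrableOn_exp_mul hf hC hc (by linarith)
  have hGI : ∀ p : ℝ, 1 < p → IntegrableOn (fun x : ℝ => exp (-(p * x)) * G x) (Ioi 0) := by
    intro p hp
    have h := (integrable_prod_laplace hγ0 hm hW hp).integral_prod_left.const_mul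
      (1 / (2 * Real.pi : ℂ))
    refine h.congr (.of_forall fun x => ?_)
    simp only [hG]
    rw [integral_const_mul]
    ring
  have hzero := eq_zero_of_laplace_eq_zero (d := fun x => f x - G x) (a := 1)
    (fun y hy => (hf y hy).sub
      (continuousAt_const.mul (continuousAt_integral_powerKernel hγ0 hm hW hy)))
    (fun p hp => by
      simp_rw [mul_sub]
      exact (hfI p hp).sub (hGI p hp))
    (fun p hp => by
      have hp0 : 0 < 1 / p := by positivity
      simp_rw [mul_sub]
      rw [integral_sub (hfI p hp) (hGI p hp), sub_eq_zero]
      -- Mellin inversion at `t = 1/p` gives `e^(-1/p)` times the Laplace transform of `f` at `p`;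
      -- the factor `e^(1/p)` from the kernel removes the exponential.
      have hinv := mellinInv_mellin_eq γ (laplaceProfile f) hp0
        (mellinConvergent_laplaceProfile hf hC hc (by simpa using hγ)) hFint
        (continuousAt_laplaceProfile hf hC hc hp0)
      have hL := laplace_integral_powerKernel hγ0 hm hW hp
      simp_rw [heq] at hL
      have e : ∀ x : ℝ, exp (-(p * x)) * G x = 1 / (2 * Real.pi) * (exp (-(p * x)) *
          ∫ τ : ℝ, powerKernel (-(γ + τ * I)) x * mellin (laplaceProfile f) (γ + τ * I)) :=
        fun x => by simp only [hG, heq]; ring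
      simp_rw [e]
      rw [integral_const_mul, hL]
      rw [mellinInv, laplaceProfile, one_div_one_div] at hinv
      have hexp : exp (1 / p : ℂ) * exp (-((1 / p : ℝ) : ℂ)) = 1 := by
        rw [← exp_add]; simp
      rw [real_smul] at hinv
      push_cast at hinv hexp ⊢
      linear_combination (-(exp (1 / (p : ℂ)))) * hinv -
        (∫ x in Ioi (0 : ℝ), exp (-(p * x)) * f x) * hexp) hx
  exact sub_eq_zero.mp hzero

end

/-! ### Assembly of the result. -/

theorem corollary1 (c₀ ε : ℝ) (hc₀ : c₀ < 1) (hε₁ : 2 * c₀ - 1 < ε) (hε₂ : ε < c₀)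
    (f : ℝ → ℂ) (hf : f ∈ inverseMellinSpace c₀ 0 ((|ε| + ε) / 2))
    (γ : ℝ) (hγ₁ : c₀ - 1 < γ) (hγ₂ : γ < 0) (hF : ExpIntegrableTransform f γ) :
    -- the transform `Ff` is given by an absolutely convergent integral on the line `Re z = γ`
    (∀ z : ℂ, z.re = γ → IntegrableOn (indexIntegrand f z) (Ioi 0)) ∧
    ∀ x : ℝ, 0 < x →
      -- the integral under the outer `d/dx` converges absolutely
      VerticalIntegrable (fun z => inversionKernel z x * indexTransform f z) γ ∧
      -- the integral after the differentiation converges absolutely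
      VerticalIntegrable (fun z => inversionKernelDeriv z x * indexTransform f z) γ ∧
      -- its kernel is the derivative of the former kernel
      (∀ z : ℂ, z.re = γ →
        HasDerivAt (fun y : ℝ => inversionKernel z y) (inversionKernelDeriv z x) x) ∧
      -- differentiation under the integral sign
      HasDerivAt
        (fun y : ℝ => verticalLineIntegral γ (fun z => inversionKernel z y * indexTransform f z))
        (verticalLineIntegral γ (fun z => inversionKernelDeriv z x * indexTransform f z)) x ∧
      -- the inversion formula with the outer derivative
      f x = 1 / (2 * (Real.pi : ℂ) * I) *
        deriv (fun y : ℝ =>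
          verticalLineIntegral γ (fun z => inversionKernel z y * indexTransform f z)) x ∧
      -- the inversion formula without it
      f x = 1 / (2 * (Real.pi : ℂ) * I) *
        verticalLineIntegral γ (fun z => inversionKernelDeriv z x * indexTransform f z) := by
  obtain ⟨fstar, hfs, -, hfx⟩ := hf
  have hcont : ∀ x, 0 < x → ContinuousAt f x := fun x hx =>
    (continuousAt_mellinInv hx hfs).congr (by
      filter_upwards [Ioi_mem_nhds hx] with y hy using (hfx y hy).symm)
  have hC : ∀ x, 0 < x →
      ‖f x‖ ≤ (1 / (2 * Real.pi) * ∫ y : ℝ, ‖fstar (c₀ + y * I)‖) * x ^ (-c₀) := fun x hx => by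
    rw [hfx x hx]
    exact norm_mellinInv_le hx fstar
  have hm := continuous_indexTransform_vertical hcont hC hc₀ hγ₁
  have hW := integrable_transformWeight hcont hC hc₀ hγ₁ hγ₂ hF
  refine ⟨fun z hz => integrableOn_indexIntegrand hcont hC hc₀ (by rwa [hz]), fun x hx => ?_⟩
  have hD : HasDerivAt
      (fun y : ℝ => verticalLineIntegral γ (fun z => inversionKernel z y * indexTransform f z))
      (verticalLineIntegral γ (fun z => inversionKernelDeriv z x * indexTransform f z)) x := by
    simp only [verticalLineIntegral, inversionKernelDeriv_eq_powerKernel hx]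
    refine ((hasDerivAt_integral_powerKernel hγ₂ hm hW hx).const_mul I).congr_of_eventuallyEq ?_
    filter_upwards [Ioi_mem_nhds hx] with y hy
    simp only [inversionKernel_eq_powerKernel hy]
  have hinv : f x = 1 / (2 * (Real.pi : ℂ) * I) *
      verticalLineIntegral γ (fun z => inversionKernelDeriv z x * indexTransform f z) := by
    simp only [verticalLineIntegral, inversionKernelDeriv_eq_powerKernel hx]
    -- The `i` from `dz = i dτ` cancels the one in `1/(2πi)`.
    rw [← mul_assoc, one_div_mul_eq_div, mul_comm (2 * (Real.pi : ℂ)) I, div_mul_cancel_left₀ I_ne_zero,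
      ← one_div]
    exact index_inversion hcont hC hc₀ hγ₁ hγ₂ hF hx
  refine ⟨?_, ?_, fun z hz => ?_, hD, by rw [hD.deriv]; exact hinv, hinv⟩
  · simp only [VerticalIntegrable, inversionKernel_eq_powerKernel hx]
    exact integrable_powerKernel_one_sub_mul hγ₂ hm hW hx
  · simp only [VerticalIntegrable, inversionKernelDeriv_eq_powerKernel hx]
    exact integrable_powerKernel_mul hγ₂ hm hW hx
  · rw [inversionKernelDeriv_eq_powerKernel hx]
    have h := hasDerivAt_powerKernel (s := -z) (by rw [neg_re, hz]; linarith) hx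
    rw [neg_add_eq_sub] at h
    refine h.congr_of_eventuallyEq ?_
    filter_upwards [Ioi_mem_nhds hx] with y hy using inversionKernel_eq_powerKernel hy z
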